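/- Let $q$ be a prime power, let $n\ge 2$ be an integer, and let $U\subsetneq \mathbb F_{q^n}$ be a proper $\mathbb F_q$-linear subspace of dimension $d_U\ge 1$. Let $G_U$ be the undirected graph whose vertices are the elements of $\mathbb F_{q^n}$ and in which two distinct vertices $a,b$ are adjacent if and only if $ab\in U$; let $\omega(G_U)$ be its clique number (the maximal size of a clique). 1. If $U$ contains no nonzero square of $\mathbb F_{q^n}$, then $\omega(G_U)\le d_U+2$. 2. Suppose that $\omega(G_U)>d_U+2$. Then there is a greatest divisor $D_U$ of $n$ such that $a^2\mathbb F_{q^{D_U}}\subseteq U$ for some nonzero $a\in\mathbb F_{q^n}$, and $1\le D_U\le d_U$. Put $$\kappa_U:=\max\left\{D_U,\ \frac78 d_U+\frac{7}{32\log_2 q}\right\}.$$ Then $\omega(G_U)=q^t+r$ for some integers $t,r\ge 0$ with $r+t\le d_U$ and $1\le t\le \kappa_U$. In particular, $q^{D_U}\le \omega(G_U)\le q^{\kappa_U}+d_U$. -/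

import Mathlib

/-- The graph `G_U` attached to an `F`-subspace `U` of an extension field `K` of `F`: its vertices
are the elements of `K`, and two distinct vertices `a`, `b` are adjacent when `a * b ∈ U`. -/
def productGraph {F K : Type*} [Field F] [Field K] [Algebra F K] (U : Submodule F K) :
    SimpleGraph K where
  Adj a b := a ≠ b ∧ a * b ∈ U
  symm := ⟨fun _ _ h => ⟨h.1.symm, by rw [mul_comm]; exact h.2⟩⟩
  loopless := ⟨fun _ h => h.1 rfl⟩

/-- The divisors `d` of `n = [K : F]` such that `a² E ⊆ U` for some nonzero `a ∈ K`, where `E` is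
the intermediate field of degree `d` over `F` (when `F` has `q` elements, this is the subfield of
`K` with `q ^ d` elements). -/
def squareSubfieldDegrees {F K : Type*} [Field F] [Field K] [Algebra F K] (U : Submodule F K) :
    Set ℕ :=
  {d | d ∣ Module.finrank F K ∧
    ∃ E : IntermediateField F K, Module.finrank F E = d ∧
      ∃ a : K, a ≠ 0 ∧ ∀ x ∈ E, a ^ 2 * x ∈ U}

/-! ### Linear algebra of cliques -/

section Span

variable {F K : Type*} [Field F] [Field K] [Algebra F K]

/-! Split a maximum clique into `B`, the elements with square in `U`, and `C`, the rest. With `V`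
the span of `B`, the set `V ∪ C` is still a clique, so maximality gives size `q ^ dim V + |C|`. No
`c ∈ C` lies in the span of the other clique elements, so `C` is independent modulo `V`; multiplying
by a nonzero element of `B` maps the whole span into `U`, whence `dim V + |C| ≤ dim U`. If `B` has
no nonzero element, the clique has at most `dim U + 2` elements. To bound `dim V`, use `V * V ≤ U`.
Either `dim (V * V) ≥ 3/2 dim V`, so `dim V ≤ 2/3 dim U`, or
`exists_intermediateField_of_finrank_mul_self_lt` gives a field `E` with `dim V ≤ dim E` and `w² E ⊆
U`. -/

theorem mul_mem_of_mem_span {U : Submodule F K} {S : Set K} {c x : K}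
    (h : ∀ b ∈ S, c * b ∈ U) (hx : x ∈ Submodule.span F S) : c * x ∈ U := by
  have : Submodule.span F S ≤ U.comap (LinearMap.mulLeft F c) :=
    Submodule.span_le.2 fun b hb => h b hb
  exact this hx

theorem finrank_le_of_mul_mem [FiniteDimensional F K] {U W : Submodule F K} {c : K} (hc : c ≠ 0)
    (h : ∀ x ∈ W, c * x ∈ U) : Module.finrank F W ≤ Module.finrank F U := by
  have hinj : Function.Injective (LinearMap.mulLeft F c) := mul_right_injective₀ hc
  rw [← (Submodule.equivMapOfInjective _ hinj W).symm.finrank_eq]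
  refine Submodule.finrank_mono ?_
  rintro _ ⟨x, hx, rfl⟩
  exact h x hx

/-- In a set whose products of distinct elements lie in `U`, an element whose square is not in `U`
is not in the span of the others. -/
theorem notMem_span_of_mul_self_notMem {U : Submodule F K} {A : Set K}
    (hA : ∀ a ∈ A, ∀ b ∈ A, a ≠ b → a * b ∈ U) {c : K} (hc : c ∈ A) (hcc : c * c ∉ U) :
    c ∉ Submodule.span F (A \ {c}) := fun h =>
  hcc (mul_mem_of_mem_span (fun b hb => hA c hc b hb.1 (Ne.symm hb.2)) h)

theorem linearIndepOn_of_mul_self_notMem {U : Submodule F K} {A C : Set K}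
    (hA : ∀ a ∈ A, ∀ b ∈ A, a ≠ b → a * b ∈ U) (hCA : C ⊆ A) (hC : ∀ c ∈ C, c * c ∉ U) :
    LinearIndepOn F id C := by
  rw [linearIndepOn_iff_notMem_span]
  intro c hc h
  rw [Set.image_id] at h
  exact notMem_span_of_mul_self_notMem hA (hCA hc) (hC c hc)
    (Submodule.span_mono (Set.sdiff_subset_sdiff_left hCA) h)

/-- A dependence of `c ∈ C` on the rest of `C` modulo the span of `B` would put `c` in the span of
`A \ {c}`, because `c ∉ B`. -/
theorem finrank_span_add_card_le [FiniteDimensional F K] {U : Submodule F K} {A B : Set K}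
    {C : Finset K} (hA : ∀ a ∈ A, ∀ b ∈ A, a ≠ b → a * b ∈ U) (hBA : B ⊆ A)
    (hB : ∀ b ∈ B, b * b ∈ U) (hCA : (C : Set K) ⊆ A) (hC : ∀ c ∈ C, c * c ∉ U) :
    Module.finrank F (Submodule.span F B) + C.card ≤ Module.finrank F (Submodule.span F A) := by
  set V := Submodule.span F B with hV
  have hind : LinearIndepOn F V.mkQ (C : Set K) := by
    rw [linearIndepOn_iff_notMem_span]
    intro c hc h
    rw [← Submodule.map_span] at h
    obtain ⟨y, hy, hyc⟩ := h
    have hyc' : c - y ∈ V := by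
      rw [← Submodule.Quotient.mk_eq_zero, Submodule.Quotient.mk_sub, sub_eq_zero]
      exact hyc.symm
    refine notMem_span_of_mul_self_notMem hA (hCA hc) (hC c hc) ?_
    have h1 : c - y ∈ Submodule.span F (A \ {c}) :=
      Submodule.span_mono
        (fun b hb => Set.mem_sdiff_singleton.2 ⟨hBA hb, fun e : b = c => hC c hc (e ▸ hB b hb)⟩) hyc'
    have h2 : y ∈ Submodule.span F (A \ {c}) :=
      Submodule.span_mono (Set.sdiff_subset_sdiff_left hCA) hy
    simpa using add_mem h1 h2
  obtain ⟨S, hSB, hSV, hS⟩ := exists_linearIndependent F B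
  have hSfin : S.Finite := hS.setFinite
  lift S to Finset K using hSfin
  have hSCi : LinearIndepOn F id (S ∪ C : Set K) :=
    LinearIndepOn.union_id_of_quotient (hSB.trans Submodule.subset_span) hS hind
  classical
  have hdisj : Disjoint S C :=
    Finset.disjoint_left.2 fun x hx hx' => hC x hx' (hB x (hSB hx))
  rw [← Finset.coe_union] at hSCi
  have h1 := finrank_span_finset_eq_card hSCi
  rw [Finset.card_union_of_disjoint hdisj] at h1
  rw [hV, ← hSV, finrank_span_finset_eq_card hS, ← h1]
  refine Submodule.finrank_mono (Submodule.span_mono ?_)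
  rw [Finset.coe_union]
  exact Set.union_subset (hSB.trans hBA) hCA

end Span

/-! ### Subspaces of small doubling and subfields -/

section Ratio

variable {F K : Type*} [Field F] [Field K] [Algebra F K]

theorem finrank_map_mulLeft {a : K} (ha : a ≠ 0) (V : Submodule F K) :
    Module.finrank F (V.map (LinearMap.mulLeft F a)) = Module.finrank F V :=
  (Submodule.equivMapOfInjective _ (mul_right_injective₀ ha) V).symm.finrank_eq

/-- The subspace of those `p ∈ V` such that `(a / b) * p` is in `V` too. -/
def ratioSubmodule (V : Submodule F K) (a b : K) : Submodule F K :=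
  V ⊓ (V.map (LinearMap.mulLeft F b)).comap (LinearMap.mulLeft F a)

/-- Both `aV` and `bV` lie in `V * V`, so small doubling makes them overlap in more than half their
dimension. -/
theorem finrank_lt_two_mul_finrank_ratioSubmodule [FiniteDimensional F K] {V : Submodule F K}
    (hV : 2 * Module.finrank F ↥(V * V) < 3 * Module.finrank F V) {a b : K}
    (ha : a ∈ V) (hb : b ∈ V) (ha0 : a ≠ 0) (hb0 : b ≠ 0) :
    Module.finrank F V < 2 * Module.finrank F (ratioSubmodule V a b) := by
  have h := Submodule.finrank_sup_add_finrank_inf_eq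
    (V.map (LinearMap.mulLeft F a)) (V.map (LinearMap.mulLeft F b))
  rw [finrank_map_mulLeft ha0, finrank_map_mulLeft hb0] at h
  have hsup : V.map (LinearMap.mulLeft F a) ⊔ V.map (LinearMap.mulLeft F b) ≤ V * V := by
    refine sup_le ?_ ?_
    · rintro _ ⟨x, hx, rfl⟩
      exact Submodule.mul_mem_mul ha hx
    · rintro _ ⟨x, hx, rfl⟩
      exact Submodule.mul_mem_mul hb hx
  have hinf : V.map (LinearMap.mulLeft F a) ⊓ V.map (LinearMap.mulLeft F b) ≤
      (ratioSubmodule V a b).map (LinearMap.mulLeft F a) := by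
    rintro _ ⟨⟨x, hx, rfl⟩, hx'⟩
    exact ⟨x, ⟨hx, hx'⟩, rfl⟩
  have h1 := Submodule.finrank_mono hsup
  have h2 := Submodule.finrank_mono hinf
  rw [finrank_map_mulLeft ha0] at h2
  omega

theorem exists_div_mul_div_eq [FiniteDimensional F K] {V : Submodule F K}
    (hV : 2 * Module.finrank F ↥(V * V) < 3 * Module.finrank F V) {a b c e : K}
    (ha : a ∈ V) (hb : b ∈ V) (hc : c ∈ V) (he : e ∈ V) (ha0 : a ≠ 0) (hc0 : c ≠ 0) :
    ∃ v ∈ V, ∃ u ∈ V, u ≠ 0 ∧ b / a * (e / c) = v / u := by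
  rcases eq_or_ne b 0 with rfl | hb0
  · exact ⟨0, V.zero_mem, a, ha, ha0, by simp⟩
  rcases eq_or_ne e 0 with rfl | he0
  · exact ⟨0, V.zero_mem, a, ha, ha0, by simp⟩
  have h := Submodule.finrank_sup_add_finrank_inf_eq (ratioSubmodule V a b) (ratioSubmodule V e c)
  have hsup : ratioSubmodule V a b ⊔ ratioSubmodule V e c ≤ V := sup_le inf_le_left inf_le_left
  have h1 := Submodule.finrank_mono hsup
  have h2 := finrank_lt_two_mul_finrank_ratioSubmodule hV ha hb ha0 hb0
  have h3 := finrank_lt_two_mul_finrank_ratioSubmodule hV he hc he0 hc0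
  have hne : ratioSubmodule V a b ⊓ ratioSubmodule V e c ≠ ⊥ := by
    intro h0
    rw [h0, finrank_bot] at h
    omega
  -- Two subspaces of more than half the dimension of `V` share some `p ≠ 0`; then `b / a = p / u`
  -- and `e / c = v / p`.
  obtain ⟨p, ⟨⟨-, u, hu, hup⟩, ⟨-, v, hv, hvp⟩⟩, hp0⟩ := Submodule.exists_mem_ne_zero_of_ne_bot hne
  simp only [LinearMap.mulLeft_apply] at hup hvp
  have hu0 : u ≠ 0 := by
    rintro rfl
    rw [mul_zero] at hup
    exact mul_ne_zero ha0 hp0 hup.symm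
  refine ⟨v, hv, u, hu, hu0, ?_⟩
  rw [div_mul_div_comm, div_eq_div_iff (mul_ne_zero ha0 hc0) hu0]
  linear_combination e * hup - a * hvp

/-- If `V` has small doubling, then the ratios of its elements form a field. -/
def ratioField [FiniteDimensional F K] (V : Submodule F K)
    (hV : 2 * Module.finrank F ↥(V * V) < 3 * Module.finrank F V)
    (w : K) (hw : w ∈ V) (hw0 : w ≠ 0) : IntermediateField F K where
  carrier := {x | ∃ v ∈ V, ∃ u ∈ V, u ≠ 0 ∧ x = v / u}
  mul_mem' := by
    rintro _ _ ⟨b, hb, a, ha, ha0, rfl⟩ ⟨e, he, c, hc, hc0, rfl⟩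
    exact exists_div_mul_div_eq hV ha hb hc he ha0 hc0
  add_mem' := by
    rintro _ _ ⟨b, hb, a, ha, ha0, rfl⟩ ⟨e, he, c, hc, hc0, rfl⟩
    rcases eq_or_ne b 0 with rfl | hb0
    · exact ⟨e, he, c, hc, hc0, by simp⟩
    -- Sums reduce to products: `b/a + e/c = (b/a) * (1 + (a/b) * (e/c)) = (b/a) * ((s + p)/s)`.
    obtain ⟨p, hp, s, hs, hs0, h⟩ := exists_div_mul_div_eq hV hb ha hc he hb0 hc0
    obtain ⟨v, hv, u, hu, hu0, h'⟩ := exists_div_mul_div_eq hV ha hb hs (add_mem hs hp) ha0 hs0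
    refine ⟨v, hv, u, hu, hu0, ?_⟩
    rw [← h', add_div, div_self hs0, ← h]
    field_simp
  algebraMap_mem' r := ⟨r • w, V.smul_mem r hw, w, hw, hw0, by
    rw [Algebra.smul_def, mul_div_cancel_right₀ _ hw0]⟩
  inv_mem' := by
    rintro _ ⟨b, hb, a, ha, ha0, rfl⟩
    rcases eq_or_ne b 0 with rfl | hb0
    · exact ⟨0, V.zero_mem, a, ha, ha0, by simp⟩
    · exact ⟨a, ha, b, hb, hb0, by simp⟩

theorem mem_ratioField [FiniteDimensional F K] {V : Submodule F K}
    {hV : 2 * Module.finrank F ↥(V * V) < 3 * Module.finrank F V}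
    {w : K} {hw : w ∈ V} {hw0 : w ≠ 0} {x : K} :
    x ∈ ratioField V hV w hw hw0 ↔ ∃ v ∈ V, ∃ u ∈ V, u ≠ 0 ∧ x = v / u :=
  Iff.rfl

/-- Division maps `V × V` onto the field, but not injectively, since `0 / 0 = 0 / w`; compare
cardinalities. -/
theorem finrank_ratioField_lt [Finite F] [FiniteDimensional F K] {V : Submodule F K}
    (hV : 2 * Module.finrank F ↥(V * V) < 3 * Module.finrank F V)
    {w : K} (hw : w ∈ V) (hw0 : w ≠ 0) :
    Module.finrank F (ratioField V hV w hw hw0) < 2 * Module.finrank F V := by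
  set E := ratioField V hV w hw hw0
  have hfin : Finite K := Module.finite_of_finite F
  have := Fintype.ofFinite V
  have := Fintype.ofFinite E
  have hmem : ∀ p : V × V, (p.1 : K) / p.2 ∈ E := by
    rintro ⟨v, u⟩
    rcases eq_or_ne (u : K) 0 with hu | hu
    · simp [hu, E.zero_mem]
    · exact ⟨v, v.2, u, u.2, hu, rfl⟩
  have hlt : Fintype.card E < Fintype.card (V × V) := by
    refine Fintype.card_lt_of_surjective_not_injective (fun p => ⟨_, hmem p⟩) ?_ ?_
    · rintro ⟨_, v, hv, u, hu, hu0, rfl⟩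
      exact ⟨(⟨v, hv⟩, ⟨u, hu⟩), rfl⟩
    · intro h
      have h2 := @h (0, 0) (0, ⟨w, hw⟩) (by simp)
      simp only [Prod.mk.injEq, true_and] at h2
      exact hw0 (congrArg Subtype.val h2).symm
  rw [← Nat.card_eq_fintype_card, ← Nat.card_eq_fintype_card, Nat.card_prod,
    Module.natCard_eq_pow_finrank (K := F) (V := E), Module.natCard_eq_pow_finrank (K := F) (V := V),
    ← pow_add] at hlt
  have := (Nat.pow_lt_pow_iff_right (Finite.one_lt_card (α := F))).1 hlt
  omega

/-- If `V ⊆ w E` and `V` has more than half of the dimension of the field `E`, then the products of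
elements of `V` span `w² E`. -/
theorem sq_mul_mem_mul_self [FiniteDimensional F K] {V : Submodule F K} (E : IntermediateField F K)
    {w : K} (hw0 : w ≠ 0) (hVE : ∀ v ∈ V, w⁻¹ * v ∈ E)
    (hdim : Module.finrank F E < 2 * Module.finrank F V) {x : K} (hx : x ∈ E) :
    w ^ 2 * x ∈ V * V := by
  by_contra hmem
  obtain ⟨f, hf, hker⟩ := Submodule.exists_le_ker_of_notMem hmem
  let V' : Submodule F E := (V.map (LinearMap.mulLeft F w⁻¹)).comap E.val.toLinearMap
  have hV' : Module.finrank F V' = Module.finrank F V := by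
    rw [← finrank_map_mulLeft (inv_ne_zero hw0) V]
    have hinj : Function.Injective E.val.toLinearMap := E.val.injective
    rw [(Submodule.equivMapOfInjective _ hinj V').finrank_eq, Submodule.map_comap_eq_self]
    rintro _ ⟨v, hv, rfl⟩
    exact ⟨⟨_, hVE v hv⟩, rfl⟩
  -- `L` embeds `V` in the annihilator of `w⁻¹ V` in the dual of `E`, whose dimension `dim E - dim
  -- V` is less than `dim V`.
  let L : V →ₗ[F] Module.Dual F E :=
    LinearMap.mk₂ F (fun v e => f (w * v * e))
      (fun _ _ _ => by simp [mul_add, add_mul]) (fun _ _ _ => by simp)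
      (fun _ _ _ => by simp [mul_add]) (fun _ _ _ => by simp)
  have hLinj : Function.Injective L := by
    rw [← LinearMap.ker_eq_bot, LinearMap.ker_eq_bot']
    intro v hv
    by_contra hv0
    have hv0' : (v : K) ≠ 0 := fun h => hv0 (Subtype.ext h)
    have h := LinearMap.congr_fun hv ⟨_, E.mul_mem hx (E.inv_mem (hVE v v.2))⟩
    refine hf ?_
    have e : w * (v : K) * (x * (w⁻¹ * (v : K))⁻¹) = w ^ 2 * x := by field_simp
    rw [← e]
    exact h
  have hrange : LinearMap.range L ≤ V'.dualAnnihilator := by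
    rintro _ ⟨v, rfl⟩
    rw [Submodule.mem_dualAnnihilator]
    rintro e ⟨u, hu, hue⟩
    have hue' : w⁻¹ * u = (e : K) := hue
    have : w * (v : K) * e = v * u := by rw [← hue']; field_simp
    change f (w * (v : K) * e) = 0
    rw [this]
    exact hker (Submodule.mul_mem_mul v.2 hu)
  have h1 := Submodule.finrank_mono hrange
  rw [LinearMap.finrank_range_of_inj hLinj] at h1
  have h2 := Subspace.finrank_add_finrank_dualAnnihilator_eq V'
  omega

/-- A multiplicative analogue of Freiman's `3 / 2` theorem for subspaces of a finite field. -/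
theorem exists_intermediateField_of_finrank_mul_self_lt [Finite F] [FiniteDimensional F K]
    {V : Submodule F K} (hV : 2 * Module.finrank F ↥(V * V) < 3 * Module.finrank F V) :
    ∃ E : IntermediateField F K, Module.finrank F V ≤ Module.finrank F E ∧
      ∃ w : K, w ≠ 0 ∧ ∀ x ∈ E, w ^ 2 * x ∈ V * V := by
  have hne : V ≠ ⊥ := by
    rintro rfl
    simp at hV
  obtain ⟨w, hw, hw0⟩ := Submodule.exists_mem_ne_zero_of_ne_bot hne
  have hVE : ∀ v ∈ V, w⁻¹ * v ∈ ratioField V hV w hw hw0 := fun v hv =>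
    ⟨v, hv, w, hw, hw0, by rw [div_eq_inv_mul]⟩
  refine ⟨ratioField V hV w hw hw0, ?_, w, hw0, fun x hx =>
    sq_mul_mem_mul_self _ hw0 hVE (finrank_ratioField_lt hV hw hw0) hx⟩
  exact finrank_le_of_mul_mem (U := (ratioField V hV w hw hw0).toSubalgebra.toSubmodule)
    (inv_ne_zero hw0) hVE

end Ratio

/-! ### Structure of maximum cliques -/

section Clique

variable {F K : Type*} [Field F] [Field K] [Algebra F K]

/-- Remove `0` and one more element `c`, which accounts for the `2`: the rest is independent, and
multiplication by `c` maps it into `U`. -/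
theorem card_le_of_forall_mul_self_notMem [FiniteDimensional F K] {U : Submodule F K}
    {A : Finset K} (hA : ∀ a ∈ A, ∀ b ∈ A, a ≠ b → a * b ∈ U)
    (h : ∀ a ∈ A, a ≠ 0 → a * a ∉ U) : A.card ≤ Module.finrank F U + 2 := by
  classical
  have h0 : A.card ≤ (A.erase 0).card + 1 :=
    Nat.le_add_of_sub_le Finset.pred_card_le_card_erase
  rcases (A.erase 0).eq_empty_or_nonempty with he | ⟨c, hc⟩
  · rw [he, Finset.card_empty] at h0
    omega
  have h1 : (A.erase 0).card ≤ ((A.erase 0).erase c).card + 1 :=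
    Nat.le_add_of_sub_le Finset.pred_card_le_card_erase
  have hc' := Finset.mem_erase.1 hc
  have hind : LinearIndepOn F id (((A.erase 0).erase c : Finset K) : Set K) := by
    refine linearIndepOn_of_mul_self_notMem (A := (A : Set K)) hA ?_ ?_
    · exact_mod_cast (Finset.erase_subset _ _).trans (Finset.erase_subset _ _)
    · intro x hx
      have hx' := Finset.mem_erase.1 (Finset.mem_erase.1 (Finset.mem_coe.1 hx)).2
      exact h x hx'.2 hx'.1
  have h2 := finrank_span_finset_eq_card hind
  have h3 : Module.finrank F (Submodule.span F (((A.erase 0).erase c : Finset K) : Set K)) ≤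
      Module.finrank F U := by
    refine finrank_le_of_mul_mem hc'.1 fun x hx => mul_mem_of_mem_span (fun b hb => ?_) hx
    have hb' := Finset.mem_erase.1 (Finset.mem_coe.1 hb)
    exact hA c hc'.2 b (Finset.mem_of_mem_erase hb'.2) (Ne.symm hb'.1)
  omega

theorem exists_finset_card_eq_cliqueNum_productGraph (U : Submodule F K) :
    ∃ A : Finset K, A.card = (productGraph U).cliqueNum ∧
      ∀ a ∈ A, ∀ b ∈ A, a ≠ b → a * b ∈ U := by
  obtain ⟨A, hA⟩ := (productGraph U).exists_isNClique_cliqueNum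
  exact ⟨A, hA.card_eq, fun a ha b hb hab => (hA.isClique ha hb hab).2⟩

theorem ncard_le_cliqueNum_productGraph [Finite K] {U : Submodule F K} {A : Set K}
    (hA : ∀ a ∈ A, ∀ b ∈ A, a ≠ b → a * b ∈ U) : A.ncard ≤ (productGraph U).cliqueNum := by
  lift A to Finset K using A.toFinite
  rw [Set.ncard_coe_finset]
  exact SimpleGraph.IsClique.card_le_cliqueNum
    (tc := fun a ha b hb hab => ⟨hab, hA a ha b hb hab⟩)

/-- A maximum clique with more than `dim U + 2` elements consists of a nonzero subspace `V` with
`V * V ≤ U` and of elements that are linearly independent modulo `V`. -/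
theorem exists_cliqueNum_productGraph_eq [Finite F] [FiniteDimensional F K] {U : Submodule F K}
    (h : Module.finrank F U + 2 < (productGraph U).cliqueNum) :
    ∃ (V : Submodule F K) (r : ℕ), V ≠ ⊥ ∧ V * V ≤ U ∧
      (productGraph U).cliqueNum = Nat.card F ^ Module.finrank F V + r ∧
      r + Module.finrank F V ≤ Module.finrank F U := by
  classical
  have hfin : Finite K := Module.finite_of_finite F
  obtain ⟨A, hcard, hA⟩ := exists_finset_card_eq_cliqueNum_productGraph U
  let B := A.filter fun a => a * a ∈ U
  let C := A.filter fun a => a * a ∉ U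
  have hB : ∀ b ∈ B, b ∈ A ∧ b * b ∈ U := fun b hb => Finset.mem_filter.1 hb
  have hC : ∀ c ∈ C, c ∈ A ∧ c * c ∉ U := fun c hc => Finset.mem_filter.1 hc
  let V := Submodule.span F (B : Set K)
  have hBB : ∀ a ∈ B, ∀ b ∈ B, a * b ∈ U := fun a ha b hb => by
    rcases eq_or_ne a b with rfl | hab
    · exact (hB a ha).2
    · exact hA a (hB a ha).1 b (hB b hb).1 hab
  have hVV : V * V ≤ U := by
    rw [Submodule.mul_le]
    intro x hx y hy
    refine mul_mem_of_mem_span (fun b hb => ?_) hy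
    rw [mul_comm]
    exact mul_mem_of_mem_span (hBB b hb) hx
  have hCV : ∀ c ∈ C, ∀ v ∈ V, c * v ∈ U := fun c hc v hv =>
    mul_mem_of_mem_span (fun b hb => hA c (hC c hc).1 b (hB b hb).1
      fun e => (hC c hc).2 (e ▸ (hB b hb).2)) hv
  have hdisj : Disjoint (V : Set K) (C : Set K) := Set.disjoint_left.2 fun x hx hx' =>
    (hC x hx').2 (hVV (Submodule.mul_mem_mul hx hx))
  have hle : ((V : Set K) ∪ C).ncard ≤ (productGraph U).cliqueNum := by
    refine ncard_le_cliqueNum_productGraph ?_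
    rintro a (ha | ha) b (hb | hb) hab
    · exact hVV (Submodule.mul_mem_mul ha hb)
    · rw [mul_comm]
      exact hCV b hb a ha
    · exact hCV a ha b hb
    · exact hA a (hC a ha).1 b (hC b hb).1 hab
  have hVcard : (V : Set K).ncard = Nat.card F ^ Module.finrank F V :=
    Module.natCard_eq_pow_finrank (K := F) (V := V)
  rw [Set.ncard_union_eq hdisj, hVcard, Set.ncard_coe_finset] at hle
  have hBle : B.card ≤ Nat.card F ^ Module.finrank F V := by
    rw [← hVcard, ← Set.ncard_coe_finset]
    exact Set.ncard_le_ncard Submodule.subset_span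
  have hBC : B.card + C.card = A.card := Finset.card_filter_add_card_filter_not _
  obtain ⟨v, hvA, hv0, hvU⟩ : ∃ a ∈ A, a ≠ 0 ∧ a * a ∈ U := by
    by_contra! hcon
    have := card_le_of_forall_mul_self_notMem hA hcon
    omega
  have hvB : v ∈ B := Finset.mem_filter.2 ⟨hvA, hvU⟩
  refine ⟨V, C.card, ?_, hVV, by omega, ?_⟩
  · intro hbot
    have : v ∈ V := Submodule.subset_span hvB
    rw [hbot, Submodule.mem_bot] at this
    exact hv0 this
  · have h1 : Module.finrank F V + C.card ≤ Module.finrank F (Submodule.span F (A : Set K)) :=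
      finrank_span_add_card_le (U := U) hA (fun b hb => (hB b hb).1) (fun b hb => (hB b hb).2)
        (fun c hc => (hC c hc).1) (fun c hc => (hC c hc).2)
    have h2 : Module.finrank F (Submodule.span F (A : Set K)) ≤ Module.finrank F U := by
      refine finrank_le_of_mul_mem hv0 fun x hx => mul_mem_of_mem_span (fun b hb => ?_) hx
      rcases eq_or_ne v b with rfl | hvb
      · exact hvU
      · exact hA v hvA b hb hvb
    omega

theorem pow_le_cliqueNum_of_mem_squareSubfieldDegrees [Finite F] [FiniteDimensional F K]
    {U : Submodule F K} {D : ℕ} (hD : D ∈ squareSubfieldDegrees U) :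
    Nat.card F ^ D ≤ (productGraph U).cliqueNum := by
  have hfin : Finite K := Module.finite_of_finite F
  obtain ⟨-, E, rfl, a, ha, h⟩ := hD
  have hcard : Nat.card F ^ Module.finrank F E = ((a * ·) '' (E : Set K)).ncard := by
    rw [Set.ncard_image_of_injective _ (mul_right_injective₀ ha)]
    exact (Module.natCard_eq_pow_finrank (K := F) (V := E)).symm
  rw [hcard]
  refine ncard_le_cliqueNum_productGraph ?_
  rintro _ ⟨x, hx, rfl⟩ _ ⟨y, hy, rfl⟩ -
  have : a * x * (a * y) = a ^ 2 * (x * y) := by ring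
  simp only [this]
  exact h _ (E.mul_mem hx hy)

theorem le_finrank_of_mem_squareSubfieldDegrees [FiniteDimensional F K]
    {U : Submodule F K} {D : ℕ} (hD : D ∈ squareSubfieldDegrees U) : D ≤ Module.finrank F U := by
  obtain ⟨-, E, rfl, a, ha, h⟩ := hD
  exact finrank_le_of_mul_mem (W := E.toSubalgebra.toSubmodule) (pow_ne_zero 2 ha) h

theorem finrank_mem_squareSubfieldDegrees {U : Submodule F K}
    (E : IntermediateField F K) {a : K} (ha : a ≠ 0) (h : ∀ x ∈ E, a ^ 2 * x ∈ U) :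
    Module.finrank F E ∈ squareSubfieldDegrees U :=
  ⟨⟨Module.finrank E K, (Module.finrank_mul_finrank F E K).symm⟩, E, rfl, a, ha, h⟩

theorem one_mem_squareSubfieldDegrees {U : Submodule F K} {a : K} (ha : a ≠ 0) (h : a * a ∈ U) :
    1 ∈ squareSubfieldDegrees U := by
  have := finrank_mem_squareSubfieldDegrees (U := U) (⊥ : IntermediateField F K) ha (by
    intro x hx
    obtain ⟨r, rfl⟩ := IntermediateField.mem_bot.1 hx
    rw [mul_comm, ← Algebra.smul_def, pow_two]
    exact U.smul_mem r h)
  rwa [IntermediateField.finrank_bot] at this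

end Clique

theorem mainTheorem3 {F K : Type*} [Field F] [Finite F] [Field K] [Algebra F K]
    (q n d : ℕ) (hq : Nat.card F = q) (hn : 2 ≤ n) (hK : Module.finrank F K = n)
    (U : Submodule F K) (hU : U ≠ ⊤) (hd : Module.finrank F U = d) (hd1 : 1 ≤ d) :
    ((¬ ∃ x ∈ U, x ≠ 0 ∧ IsSquare x) → (productGraph U).cliqueNum ≤ d + 2) ∧
    (d + 2 < (productGraph U).cliqueNum →
      ∃ D : ℕ, IsGreatest (squareSubfieldDegrees U) D ∧ 1 ≤ D ∧ D ≤ d ∧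
        (∃ t r : ℕ, (productGraph U).cliqueNum = q ^ t + r ∧ r + t ≤ d ∧ 1 ≤ t ∧
          (t : ℝ) ≤ max (D : ℝ) (7 / 8 * (d : ℝ) + 7 / (32 * Real.logb 2 (q : ℝ)))) ∧
        q ^ D ≤ (productGraph U).cliqueNum ∧
        ((productGraph U).cliqueNum : ℝ) ≤
          (q : ℝ) ^ max (D : ℝ) (7 / 8 * (d : ℝ) + 7 / (32 * Real.logb 2 (q : ℝ))) + (d : ℝ)) := by
  have hfd : FiniteDimensional F K := Module.finite_of_finrank_pos (by omega)
  subst hq hd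
  refine ⟨fun hsq => ?_, fun hlt => ?_⟩
  · obtain ⟨A, hcard, hA⟩ := exists_finset_card_eq_cliqueNum_productGraph U
    rw [← hcard]
    exact card_le_of_forall_mul_self_notMem hA fun a _ ha0 haU =>
      hsq ⟨a * a, haU, mul_ne_zero ha0 ha0, a, rfl⟩
  obtain ⟨V, r, hVbot, hVU, hcard, hr⟩ := exists_cliqueNum_productGraph_eq hlt
  obtain ⟨v, hv, hv0⟩ := Submodule.exists_mem_ne_zero_of_ne_bot hVbot
  have h1 : 1 ∈ squareSubfieldDegrees U :=
    one_mem_squareSubfieldDegrees hv0 (hVU (Submodule.mul_mem_mul hv hv))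
  have hbdd : BddAbove (squareSubfieldDegrees U) :=
    ⟨_, fun D hD => le_finrank_of_mem_squareSubfieldDegrees hD⟩
  have hmem : sSup (squareSubfieldDegrees U) ∈ squareSubfieldDegrees U := Nat.sSup_mem ⟨1, h1⟩ hbdd
  set D := sSup (squareSubfieldDegrees U)
  have hgreatest : IsGreatest (squareSubfieldDegrees U) D := ⟨hmem, fun x hx => le_csSup hbdd hx⟩
  have hq1 : 1 < Nat.card F := Finite.one_lt_card
  have hq1' : (1 : ℝ) < (Nat.card F : ℝ) := by exact_mod_cast hq1
  have ht : (Module.finrank F V : ℝ) ≤ max (D : ℝ)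
      (7 / 8 * (Module.finrank F U : ℝ) + 7 / (32 * Real.logb 2 (Nat.card F : ℝ))) := by
    by_cases hsmall : 2 * Module.finrank F ↥(V * V) < 3 * Module.finrank F V
    · obtain ⟨E, hVE, w, hw0, hw⟩ := exists_intermediateField_of_finrank_mul_self_lt hsmall
      have hED := hgreatest.2
        (finrank_mem_squareSubfieldDegrees E hw0 fun x hx => hVU (hw x hx))
      exact le_max_of_le_left (by exact_mod_cast hVE.trans hED)
    -- Here `dim V ≤ 2/3 dim U`, which is below `7/8 dim U`; the logarithmic term is only needed to
    -- be nonnegative.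
    · refine le_max_of_le_right ?_
      have hle := Submodule.finrank_mono hVU
      have h3 : 3 * Module.finrank F V ≤ 2 * Module.finrank F U := by omega
      have h3' : 3 * (Module.finrank F V : ℝ) ≤ 2 * (Module.finrank F U : ℝ) := by
        exact_mod_cast h3
      have hlog : 0 ≤ 7 / (32 * Real.logb 2 (Nat.card F : ℝ)) :=
        div_nonneg (by norm_num)
          (mul_nonneg (by norm_num) (Real.logb_nonneg (by norm_num) hq1'.le))
      have hU0 : (0 : ℝ) ≤ Module.finrank F U := Nat.cast_nonneg _
      linarith
  refine ⟨D, hgreatest, hgreatest.2 h1, le_finrank_of_mem_squareSubfieldDegrees hmem,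
    ⟨Module.finrank F V, r, hcard, hr, ?_, ht⟩,
    pow_le_cliqueNum_of_mem_squareSubfieldDegrees hmem, ?_⟩
  · exact Submodule.one_le_finrank_iff.2 hVbot
  · rw [hcard]
    push_cast
    refine add_le_add ?_ (by exact_mod_cast le_of_add_le_left hr)
    rw [← Real.rpow_natCast]
    exact Real.rpow_le_rpow_of_exponent_le hq1'.le ht
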